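/- Let $(x(n))_{n\ge 0}$ be a real-valued Gaussian process (all finite-dimensional distributions are Gaussian) that is zero-mean and wide-sense stationary, with autocovariance $S(\tau)=\mathbb{E}[x(n)x(n+\tau)]$, positive variance $S=S(0)>0$, and satisfying the mixing assumption $\sum_{\tau=0}^{\infty}|S(\tau)|^2<\infty$. For $N\ge 1$ let $$\hat S=\frac1N\sum_{n=1}^N x(n)^2,\qquad \hat B_1(N)=\frac1N\sum_{n=1}^N\big(x(n)\,\hat S^{-1}\,x(n)\big)^2$$ be the sample kurtosis. Then, for every $N\ge1$, $\hat S>0$ almost surely and $\hat B_1(N)$ is square integrable, and as $N\to\infty$ (for the fixed process) $$\mathbb{E}[\hat B_1(N)]=3-\frac6N-\frac{12}{N^2}\sum_{\tau=1}^{N-1}(N-\tau)\frac{S(\tau)^2}{S^2}+o\!\left(\frac1N\right),$$ $$\mathrm{Var}[\hat B_1(N)]=\frac{24}{N}\Big[1+\frac2N\sum_{\tau=1}^{N-1}(N-\tau)\frac{S(\tau)^4}{S^4}\Big]+o\!\left(\frac1N\right).$$ In particular, if the $x(n)$ are moreover independent (the i.i.d. case), then $S(\tau)=0$ for all $\tau\ge1$,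 and $\mathbb{E}[\hat B_1(N)]=3-\frac6N+o(\frac1N)$ and $\mathrm{Var}[\hat B_1(N)]=\frac{24}{N}+o(\frac1N)$. -/

import Mathlib

open MeasureTheory ProbabilityTheory Filter Asymptotics
open scoped Topology

/-- A real discrete-time process is wide-sense (second-order) stationary if it is square
integrable, has constant mean, and the covariance of `X n` and `X (n + τ)` depends on the lag `τ`
only. For Gaussian processes this is equivalent to strict stationarity. -/
structure IsWideSenseStationary {Ω : Type*} [MeasurableSpace Ω] (X : ℕ → Ω → ℝ)
    (μ : Measure Ω) : Prop where
  memLp : ∀ n, MemLp (X n) 2 μ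
  mean_eq : ∀ n, ∫ ω, X n ω ∂μ = ∫ ω, X 0 ω ∂μ
  cov_eq : ∀ n τ, cov[X n, X (n + τ); μ] = cov[X 0, X τ; μ]

/-- The autocovariance function `S(τ)` of a stationary process; `S = S(0)` is its variance. -/
noncomputable def autocov {Ω : Type*} [MeasurableSpace Ω] (X : ℕ → Ω → ℝ) (μ : Measure Ω)
    (τ : ℕ) : ℝ :=
  cov[X 0, X τ; μ]

/-- The sample second moment `Ŝ = (1/N) ∑_{n=1}^N x(n)²`. -/
noncomputable def sampleVar {Ω : Type*} (X : ℕ → Ω → ℝ) (N : ℕ) (ω : Ω) : ℝ :=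
  (1 / (N : ℝ)) * ∑ n ∈ Finset.Icc 1 N, X n ω * X n ω

/-- The scalar sample kurtosis `B̂₁(N) = (1/N) ∑_{n=1}^N (x(n) Ŝ⁻¹ x(n))²`. -/
noncomputable def sampleKurtosis {Ω : Type*} (X : ℕ → Ω → ℝ) (N : ℕ) (ω : Ω) : ℝ :=
  (1 / (N : ℝ)) * ∑ n ∈ Finset.Icc 1 N, (X n ω * (sampleVar X N ω)⁻¹ * X n ω) ^ 2

/-!
Divide the process by its standard deviation to get `Y` with unit variances and correlations `r`, and
let `U`, `V` be the averages over `n = 1, …, N` of the Hermite polynomials `He₂(Y n) = Y² - 1` and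
`He₄(Y n) = Y⁴ - 6Y² + 3`. Almost surely the sample kurtosis is
`B = 3 + (V - 3U²) / (1 + U)²` (`sampleKurtosis_sub_three_eq`). Orthogonality of Hermite polynomials
(`integral_realHermite_mul`) gives `𝔼 U² = 2 N⁻² ∑∑ r²`, `𝔼 V² = 24 N⁻² ∑∑ r⁴` and `𝔼 U V = 0`, so that
the asserted expansions say that `𝔼 B = 3 - 3 𝔼 U²` and `Var B = 𝔼 V²` up to `o(1 / N)`. Square
summability of the autocovariance makes both second moments `O(1 / N)`.

The error is controlled by two facts. First, `0 ≤ B ≤ N` holds everywhere, so the singularity at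
`U = -1` costs at most `N² P(|U| > 1/2)`, which is `O(N² 𝔼 U⁸)`; on `|U| ≤ 1/2` the ratio is expanded
directly (`abs_ratio_sub_linear_le`, `abs_ratio_sq_sub_sq_le`). Second, hypercontractivity:
`‖F‖₈² ≤ 7^k ‖F‖₂²` for every `F = ∑ c_n He_k(Y n)` (`integral_hermiteSum_pow_eight_le`), whence
`𝔼 U⁸ = O(N⁻⁴)` and `𝔼 U⁴`, `𝔼 V⁴ = O(N⁻²)`. This has a short proof by induction on `k`. Gaussian
integration by parts turns `𝔼 F⁸` into `7k ∑_{n,m} c_n c_m r(n,m) 𝔼[F⁶ He_{k-1}(Y n) He_{k-1}(Y m)]`;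
writing `r(n,m) = ∑ᵢ A i n * A i m` makes this `7k ∑ᵢ 𝔼[F⁶ Sᵢ²]` with
`Sᵢ = ∑ c_n A i n He_{k-1}(Y n)`; Hölder's inequality and the induction hypothesis for `Sᵢ` reduce it
to `∑ᵢ 𝔼 Sᵢ²`, and `k ∑ᵢ 𝔼 Sᵢ² = 𝔼 F²`. Integration by parts itself only needs polynomials in one
standard Gaussian variable, because the residuals `Y m - r(n,m) Y n` are independent of `Y n`.
-/

/-! ### Random variables with moments of all orders -/

/-- A real random variable has all moments if it lies in `L^p` for every finite `p`. -/
def HasAllMoments {Ω : Type*} [MeasurableSpace Ω] (f : Ω → ℝ) (μ : Measure Ω) : Prop :=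
  ∀ p : NNReal, MemLp f p μ

namespace HasAllMoments

variable {Ω : Type*} [MeasurableSpace Ω] {μ : Measure Ω} {f g : Ω → ℝ}

lemma const [IsFiniteMeasure μ] (c : ℝ) : HasAllMoments (fun _ => c) μ := fun _ => memLp_const c

lemma add (hf : HasAllMoments f μ) (hg : HasAllMoments g μ) :
    HasAllMoments (fun ω => f ω + g ω) μ := fun p => (hf p).add (hg p)

lemma sub (hf : HasAllMoments f μ) (hg : HasAllMoments g μ) :
    HasAllMoments (fun ω => f ω - g ω) μ := fun p => (hf p).sub (hg p)

lemma mul (hf : HasAllMoments f μ) (hg : HasAllMoments g μ) :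
    HasAllMoments (fun ω => f ω * g ω) μ := by
  intro p
  have : ENNReal.HolderTriple ((2 * p : NNReal) : ENNReal) ((2 * p : NNReal) : ENNReal) p := by
    constructor
    by_cases hp : p = 0
    · simp [hp]
    · rw [← ENNReal.coe_inv (by positivity), ← ENNReal.coe_inv (by positivity), ← ENNReal.coe_add]
      congr 1
      field_simp
      norm_num
  exact (hg (2 * p)).mul' (hf (2 * p))

lemma const_mul (c : ℝ) (hf : HasAllMoments f μ) : HasAllMoments (fun ω => c * f ω) μ :=
  fun p => (hf p).const_mul c

lemma abs (hf : HasAllMoments f μ) : HasAllMoments (fun ω => |f ω|) μ := fun p => (hf p).abs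

lemma pow [IsFiniteMeasure μ] (hf : HasAllMoments f μ) (n : ℕ) :
    HasAllMoments (fun ω => f ω ^ n) μ := by
  induction n with
  | zero => simpa using const (μ := μ) 1
  | succ n ih => simpa only [pow_succ] using ih.mul hf

lemma sum {ι : Type*} (s : Finset ι) {F : ι → Ω → ℝ} (hF : ∀ i ∈ s, HasAllMoments (F i) μ) :
    HasAllMoments (fun ω => ∑ i ∈ s, F i ω) μ := fun p =>
  memLp_finsetSum s fun i hi => hF i hi p

lemma polynomial_eval [IsFiniteMeasure μ] (P : Polynomial ℝ) (hf : HasAllMoments f μ) :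
    HasAllMoments (fun ω => P.eval (f ω)) μ := by
  simp only [Polynomial.eval_eq_sum, Polynomial.sum]
  exact sum _ fun i _ => (hf.pow i).const_mul _

lemma integrable (hf : HasAllMoments f μ) : Integrable f μ := by
  have := hf 1
  simpa [memLp_one_iff_integrable] using this

lemma memLp_two (hf : HasAllMoments f μ) : MemLp f 2 μ := by simpa using hf 2

end HasAllMoments

lemma ProbabilityTheory.HasGaussianLaw.hasAllMoments {Ω : Type*} [MeasurableSpace Ω]
    {μ : Measure Ω} {f : Ω → ℝ} (hf : HasGaussianLaw f μ) : HasAllMoments f μ :=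
  fun _ => hf.memLp ENNReal.coe_ne_top

/-! ### Hermite polynomials and integration by parts on the line -/

/-- The probabilists' Hermite polynomial, with real coefficients. -/
noncomputable def realHermite (k : ℕ) : Polynomial ℝ :=
  (Polynomial.hermite k).map (Int.castRingHom ℝ)

@[simp] lemma realHermite_zero : realHermite 0 = 1 := by simp [realHermite]

lemma realHermite_succ (k : ℕ) :
    realHermite (k + 1) = Polynomial.X * realHermite k - (realHermite k).derivative := by
  simp [realHermite, Polynomial.derivative_map]

lemma derivative_realHermite_succ (k : ℕ) :
    (realHermite (k + 1)).derivative = Polynomial.C (k + 1 : ℝ) * realHermite k := by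
  induction k with
  | zero => simp [realHermite_succ]
  | succ k ih =>
    rw [realHermite_succ (k + 1), Polynomial.derivative_sub, Polynomial.derivative_mul, ih,
      Polynomial.derivative_C_mul]
    have h := realHermite_succ k
    have h' : (realHermite k).derivative = Polynomial.X * realHermite k - realHermite (k + 1) := by
      rw [h]; ring
    rw [h', Polynomial.derivative_X]
    push_cast
    simp only [Polynomial.C_add, Polynomial.C_1]
    ring

lemma realHermite_two_eval (x : ℝ) : (realHermite 2).eval x = x ^ 2 - 1 := by
  simp [realHermite_succ]; ring

lemma realHermite_four_eval (x : ℝ) : (realHermite 4).eval x = x ^ 4 - 6 * x ^ 2 + 3 := by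
  simp [realHermite_succ]; ring

lemma hasDerivAt_gaussianPDFReal_std (x : ℝ) :
    HasDerivAt (gaussianPDFReal 0 1) (-x * gaussianPDFReal 0 1 x) x := by
  have h : gaussianPDFReal 0 1 = fun x => (√(2 * Real.pi * (1 : NNReal)))⁻¹ *
      Real.exp (-(x - 0) ^ 2 / (2 * (1 : NNReal))) := by
    rw [gaussianPDFReal_def]
  rw [h]
  have h1 : HasDerivAt (fun x : ℝ => -(x - 0) ^ 2 / (2 * ((1 : NNReal) : ℝ))) (-x) x := by
    have := (((hasDerivAt_id x).sub_const 0).pow 2).neg.div_const (2 * ((1 : NNReal) : ℝ))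
    refine this.congr_deriv ?_
    simp
    ring
  refine (h1.exp.const_mul (√(2 * Real.pi * (1 : NNReal)))⁻¹).congr_deriv ?_
  ring

lemma hasAllMoments_id_gaussianReal : HasAllMoments (fun x : ℝ => x) (gaussianReal 0 1) :=
  fun p => memLp_id_gaussianReal p

lemma integrable_mul_gaussianPDFReal (P : Polynomial ℝ) :
    Integrable (fun x => P.eval x * gaussianPDFReal 0 1 x) := by
  have h := (hasAllMoments_id_gaussianReal.polynomial_eval P).integrable
  rw [gaussianReal_of_var_ne_zero _ one_ne_zero, integrable_withDensity_iff_integrable_smul'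
    (measurable_gaussianPDF _ _) (ae_of_all _ fun _ => gaussianPDF_lt_top)] at h
  simpa [toReal_gaussianPDF, mul_comm] using h

/-- Integration by parts against the standard Gaussian measure. -/
lemma integral_X_mul_sub_derivative_gaussianReal (P : Polynomial ℝ) :
    ∫ x, (Polynomial.X * P - P.derivative).eval x ∂(gaussianReal 0 1) = 0 := by
  have h := integral_mul_deriv_eq_deriv_mul_of_integrable
    (u := fun x => P.eval x) (v := gaussianPDFReal 0 1) (u' := fun x => P.derivative.eval x)
    (v' := fun x => -x * gaussianPDFReal 0 1 x)
    (fun x _ => P.hasDerivAt x) (fun x _ => hasDerivAt_gaussianPDFReal_std x)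
    (by
      refine (integrable_mul_gaussianPDFReal (-(Polynomial.X * P))).congr (ae_of_all _ fun x => ?_)
      simp; ring)
    (integrable_mul_gaussianPDFReal _) (integrable_mul_gaussianPDFReal _)
  rw [integral_gaussianReal_eq_integral_smul one_ne_zero]
  have h1 := integrable_mul_gaussianPDFReal (Polynomial.X * P)
  have h2 := integrable_mul_gaussianPDFReal P.derivative
  have e1 : ∫ x, P.eval x * (-x * gaussianPDFReal 0 1 x) =
      - ∫ x, (Polynomial.X * P).eval x * gaussianPDFReal 0 1 x := by
    rw [← integral_neg]; congr 1; ext x; simp; ring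
  rw [e1, neg_inj] at h
  rw [← sub_eq_zero, ← integral_sub h1 h2] at h
  refine Eq.trans (integral_congr_ae (ae_of_all _ fun x => ?_)) h
  simp only [smul_eq_mul, Polynomial.eval_sub]
  ring

/-! ### Standardised Gaussian processes -/

/-- A centred Gaussian process `Y` with unit variances and correlation function `r`. -/
structure IsStdGaussianProcess {Ω T : Type*} [MeasurableSpace Ω] (Y : T → Ω → ℝ) (r : T → T → ℝ)
    (μ : Measure Ω) : Prop where
  gauss : IsGaussianProcess Y μ
  mean : ∀ t, ∫ ω, Y t ω ∂μ = 0
  corr : ∀ s t, ∫ ω, Y s ω * Y t ω ∂μ = r s t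
  diag : ∀ t, r t t = 1

namespace IsStdGaussianProcess

variable {Ω T : Type*} [MeasurableSpace Ω] {Y : T → Ω → ℝ} {r : T → T → ℝ} {μ : Measure Ω}

lemma hasAllMoments (hY : IsStdGaussianProcess Y r μ) (t : T) : HasAllMoments (Y t) μ :=
  (hY.gauss.hasGaussianLaw_eval t).hasAllMoments

variable [IsProbabilityMeasure μ]

lemma covariance_eq (hY : IsStdGaussianProcess Y r μ) (s t : T) : cov[Y s, Y t; μ] = r s t := by
  rw [covariance_eq_sub (hY.hasAllMoments s).memLp_two (hY.hasAllMoments t).memLp_two, hY.mean,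
    ← hY.corr]
  simp

lemma map_eq (hY : IsStdGaussianProcess Y r μ) (t : T) : μ.map (Y t) = gaussianReal 0 1 := by
  rw [(hY.gauss.hasGaussianLaw_eval t).map_eq_gaussianReal, hY.mean,
    ← covariance_self (hY.gauss.aemeasurable t), hY.covariance_eq, hY.diag]
  simp

/-- Subtracting from a Gaussian process its regression on one coordinate leaves a process
independent of that coordinate. -/
lemma indepFun_regression [Countable T] (hY : IsStdGaussianProcess Y r μ) (n : T) :
    IndepFun (Y n) (fun ω t => Y t ω - r n t * Y n ω) μ := by
  classical
  have hG : IsGaussianProcess (Sum.elim (fun (_ : Unit) => Y n)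
      (fun t ω => Y t ω - r n t * Y n ω)) μ := by
    refine hY.gauss.of_isGaussianProcess fun s => ?_
    rcases s with _ | t
    · exact ⟨{n}, ContinuousLinearMap.proj ⟨n, by simp⟩, fun ω => by simp⟩
    · exact ⟨{n, t}, ContinuousLinearMap.proj ⟨t, by simp⟩ -
        r n t • ContinuousLinearMap.proj ⟨n, by simp⟩, fun ω => by simp⟩
  have h := hG.indepFun_of_covariance_eq_zero (fun _ => hY.gauss.aemeasurable n)
    (fun t => (hY.gauss.aemeasurable t).sub ((hY.gauss.aemeasurable n).const_mul _))
    (fun _ t => by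
      have h2 := fun t => (hY.hasAllMoments t).memLp_two
      rw [covariance_fun_sub_right (h2 n) (h2 t) ((h2 n).const_mul _),
        covariance_const_mul_right, hY.covariance_eq, hY.covariance_eq, hY.diag]
      simp)
  exact h.comp (φ := fun f : Unit → ℝ => f ()) (ψ := id) (measurable_pi_apply _) measurable_id

/-- Integration by parts in the coordinate `Y n`, the regression residuals being frozen: for each
value `e` of the residuals, `Q e` is a polynomial in `Y n`. -/
lemma integral_stein [Countable T] (hY : IsStdGaussianProcess Y r μ) (n : T)
    (Q : (T → ℝ) → Polynomial ℝ)
    (hQ : Measurable fun z : ℝ × (T → ℝ) =>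
      (Polynomial.X * Q z.2 - (Q z.2).derivative).eval z.1)
    (hint : Integrable (fun ω => (Polynomial.X * Q (fun t => Y t ω - r n t * Y n ω) -
      (Q (fun t => Y t ω - r n t * Y n ω)).derivative).eval (Y n ω)) μ) :
    ∫ ω, (Polynomial.X * Q (fun t => Y t ω - r n t * Y n ω) -
      (Q (fun t => Y t ω - r n t * Y n ω)).derivative).eval (Y n ω) ∂μ = 0 := by
  have hn := hY.gauss.aemeasurable n
  have he : AEMeasurable (fun ω t => Y t ω - r n t * Y n ω) μ :=
    aemeasurable_pi_iff.2 fun t => (hY.gauss.aemeasurable t).sub (hn.const_mul _)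
  have hmap := (indepFun_iff_map_prod_eq_prod_map_map hn he).1 (hY.indepFun_regression n)
  have hpe : IsProbabilityMeasure (μ.map fun ω t => Y t ω - r n t * Y n ω) :=
    Measure.isProbabilityMeasure_map he
  have h1 := integral_map (hn.prodMk he) (f := fun z : ℝ × (T → ℝ) =>
    (Polynomial.X * Q z.2 - (Q z.2).derivative).eval z.1) hQ.aestronglyMeasurable
  have h2 := (integrable_map_measure (μ := μ) (f := fun ω => (Y n ω, fun t => Y t ω - r n t * Y n ω))
    (g := fun z : ℝ × (T → ℝ) => (Polynomial.X * Q z.2 - (Q z.2).derivative).eval z.1)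
    hQ.aestronglyMeasurable (hn.prodMk he)).2 (by simpa only [Function.comp_def] using hint)
  rw [← h1]
  rw [hmap, hY.map_eq] at h2 ⊢
  rw [integral_prod_symm _ h2]
  simp only [integral_X_mul_sub_derivative_gaussianReal, integral_zero]

/-- Gaussian integration by parts for a weighted sum of Hermite polynomials of the process. -/
lemma integral_realHermite_mul_pow [Countable T] (hY : IsStdGaussianProcess Y r μ) (n : T)
    (s : Finset T) (c : T → ℝ) (k j q : ℕ) :
    ∫ ω, (realHermite (k + 1)).eval (Y n ω) *
        (∑ m ∈ s, c m * (realHermite (j + 1)).eval (Y m ω)) ^ (q + 1) ∂μ =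
      (q + 1) * (j + 1) * ∑ m ∈ s, r n m * c m *
        ∫ ω, (realHermite k).eval (Y n ω) * (realHermite j).eval (Y m ω) *
          (∑ m ∈ s, c m * (realHermite (j + 1)).eval (Y m ω)) ^ q ∂μ := by
  have hH : ∀ k m, HasAllMoments (fun ω => (realHermite k).eval (Y m ω)) μ := fun k m =>
    (hY.hasAllMoments m).polynomial_eval _
  have hF : HasAllMoments (fun ω => ∑ m ∈ s, c m * (realHermite (j + 1)).eval (Y m ω)) μ :=
    HasAllMoments.sum _ fun m _ => (hH _ m).const_mul _
  -- with residuals `e`, the sum is a polynomial in `Y n` because `Y m = r n m * Y n + e m`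
  let F : (T → ℝ) → Polynomial ℝ := fun e => ∑ m ∈ s, Polynomial.C (c m) *
    (realHermite (j + 1)).comp (Polynomial.C (r n m) * Polynomial.X + Polynomial.C (e m))
  let Q : (T → ℝ) → Polynomial ℝ := fun e => realHermite k * F e ^ (q + 1)
  have key : ∀ (x : ℝ) (e : T → ℝ),
      (Polynomial.X * Q e - (Q e).derivative).eval x =
        (realHermite (k + 1)).eval x *
          (∑ m ∈ s, c m * (realHermite (j + 1)).eval (r n m * x + e m)) ^ (q + 1) -
        (q + 1) * (j + 1) * ∑ m ∈ s, r n m * c m * ((realHermite k).eval x *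
          (realHermite j).eval (r n m * x + e m) *
          (∑ m ∈ s, c m * (realHermite (j + 1)).eval (r n m * x + e m)) ^ q) := by
    intro x e
    simp only [Q, F, realHermite_succ k, Polynomial.derivative_mul, Polynomial.derivative_pow,
      Polynomial.derivative_sum, Polynomial.derivative_comp, derivative_realHermite_succ j,
      Polynomial.eval_sub, Polynomial.eval_mul, Polynomial.eval_add, Polynomial.eval_pow,
      Polynomial.eval_finsetSum, Polynomial.eval_comp, Polynomial.eval_C, Polynomial.eval_X,
      Polynomial.derivative_C, Polynomial.derivative_X, Polynomial.derivative_add, Polynomial.eval_zero,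
      Polynomial.mul_comp, Polynomial.C_comp, Polynomial.eval_one, Finset.mul_sum]
    have : ∑ m ∈ s, (q + 1 : ℝ) * (j + 1) * (r n m * c m * ((realHermite k).eval x *
          (realHermite j).eval (r n m * x + e m) *
          (∑ m ∈ s, c m * (realHermite (j + 1)).eval (r n m * x + e m)) ^ q)) = 
        (realHermite k).eval x * ((q + 1 : ℝ) *
          (∑ m ∈ s, c m * (realHermite (j + 1)).eval (r n m * x + e m)) ^ q *
          ∑ m ∈ s, c m * (r n m * ((j + 1) * (realHermite j).eval (r n m * x + e m)))) := by
      simp only [Finset.mul_sum]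
      refine Finset.sum_congr rfl fun m _ => ?_
      ring
    rw [this]
    simp [Finset.mul_sum]
    ring
  have hYe : ∀ ω m, r n m * Y n ω + (Y m ω - r n m * Y n ω) = Y m ω := fun ω m => by ring
  have hI1 := ((hH (k + 1) n).mul (hF.pow (q + 1))).integrable
  have hI2 : ∀ m ∈ s, Integrable (fun ω => r n m * c m * ((realHermite k).eval (Y n ω) *
      (realHermite j).eval (Y m ω) *
          (∑ m ∈ s, c m * (realHermite (j + 1)).eval (Y m ω)) ^ q)) μ := fun m _ =>
    ((((hH k n).mul (hH j m)).mul (hF.pow q)).const_mul _).integrable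
  have hI3 := (integrable_finsetSum s hI2).const_mul ((q + 1 : ℝ) * (j + 1))
  have hst := hY.integral_stein n Q
    (by
      simp only [key]
      have := fun k => (realHermite k).continuous.measurable
      fun_prop)
    (by
      simp only [key, hYe]
      exact hI1.sub hI3)
  simp only [key, hYe] at hst
  rw [integral_sub hI1 hI3, sub_eq_zero, integral_const_mul, integral_finsetSum s hI2] at hst
  simpa only [integral_const_mul] using hst

end IsStdGaussianProcess

/-! ### Second moments and hypercontractivity of Hermite sums -/

/-- The Cauchy–Schwarz inequality for integrals, in squared form. -/
lemma HasAllMoments.sq_integral_mul_le {Ω : Type*} [MeasurableSpace Ω] {μ : Measure Ω}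
    {f g : Ω → ℝ} [IsFiniteMeasure μ] (hf : HasAllMoments f μ) (hg : HasAllMoments g μ) :
    (∫ ω, f ω * g ω ∂μ) ^ 2 ≤ (∫ ω, f ω ^ 2 ∂μ) * ∫ ω, g ω ^ 2 ∂μ := by
  have h : ∀ t : ℝ, 0 ≤ (∫ ω, g ω ^ 2 ∂μ) * (t * t) + (-2 * ∫ ω, f ω * g ω ∂μ) * t +
      ∫ ω, f ω ^ 2 ∂μ := by
    intro t
    have h0 : 0 ≤ ∫ ω, (t * t * g ω ^ 2 + (-2 * t) * (f ω * g ω) + f ω ^ 2) ∂μ := by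
      refine integral_nonneg fun ω => ?_
      have := sq_nonneg (f ω - t * g ω)
      simp only [Pi.zero_apply]
      nlinarith
    have i1 := ((hg.pow 2).const_mul (t * t)).integrable
    have i2 := ((hf.mul hg).const_mul (-2 * t)).integrable
    rw [integral_add (f := fun ω => t * t * g ω ^ 2 + (-2 * t) * (f ω * g ω)) (i1.add i2)
      (hf.pow 2).integrable, integral_add i1 i2, integral_const_mul, integral_const_mul] at h0
    linarith
  have := discrim_le_zero h
  rw [discrim] at this
  linarith

/-- The sum `∑_{m ∈ s} c_m He_k(Y_m)`. -/
noncomputable def hermiteSum {Ω T : Type*} (Y : T → Ω → ℝ) (s : Finset T) (k : ℕ) (c : T → ℝ)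
    (ω : Ω) : ℝ :=
  ∑ m ∈ s, c m * (realHermite k).eval (Y m ω)

namespace IsStdGaussianProcess

variable {Ω T : Type*} [MeasurableSpace Ω] {Y : T → Ω → ℝ} {r : T → T → ℝ} {μ : Measure Ω}

/-- A correlation matrix is a Gram matrix. -/
lemma exists_gram (hY : IsStdGaussianProcess Y r μ) (s : Finset T) :
    ∃ (d : ℕ) (A : Fin d → T → ℝ), ∀ n ∈ s, ∀ m ∈ s, r n m = ∑ i, A i n * A i m := by
  classical
  let R : Matrix s s ℝ := Matrix.of fun n m => r n m
  have hR : R.PosSemidef := by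
    refine Matrix.PosSemidef.of_dotProduct_mulVec_nonneg ?_ fun x => ?_
    · ext n m
      simp only [R, Matrix.conjTranspose_apply, Matrix.of_apply, star_trivial, ← hY.corr]
      congr 1; ext ω; ring
    · have h0 : 0 ≤ ∫ ω, (∑ n : s, x n * Y n ω) ^ 2 ∂μ := integral_nonneg fun ω => sq_nonneg _
      have h : ∀ n m : s, Integrable (fun ω => x n * Y n ω * (x m * Y m ω)) μ := fun n m =>
        (((hY.hasAllMoments n).const_mul _).mul ((hY.hasAllMoments m).const_mul _)).integrable
      simp only [sq, Finset.sum_mul_sum] at h0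
      rw [integral_finsetSum _ fun n _ => integrable_finsetSum _ fun m _ => h n m] at h0
      refine h0.trans_eq ?_
      simp only [dotProduct, Matrix.mulVec, R, Matrix.of_apply, star_trivial, Pi.star_apply,
        Finset.mul_sum]
      refine Finset.sum_congr rfl fun n _ => ?_
      rw [integral_finsetSum _ fun m _ => h n m]
      refine Finset.sum_congr rfl fun m _ => ?_
      rw [show x n * (r n m * x m) = x n * x m * r n m by ring, ← hY.corr, ← integral_const_mul]
      congr 1; ext ω; ring
  obtain ⟨d, v, hv⟩ := Matrix.posSemidef_iff_eq_sum_vecMulVec.1 hR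
  refine ⟨d, fun i t => if h : t ∈ s then v i ⟨t, h⟩ else 0, fun n hn m hm => ?_⟩
  have := congrFun (congrFun hv ⟨n, hn⟩) ⟨m, hm⟩
  simpa [R, Matrix.sum_apply, Matrix.vecMulVec_apply, hn, hm] using this

variable [IsProbabilityMeasure μ]

lemma hasAllMoments_realHermite (hY : IsStdGaussianProcess Y r μ) (k : ℕ) (t : T) :
    HasAllMoments (fun ω => (realHermite k).eval (Y t ω)) μ :=
  (hY.hasAllMoments t).polynomial_eval _

lemma hasAllMoments_hermiteSum (hY : IsStdGaussianProcess Y r μ) (s : Finset T) (k : ℕ)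
    (c : T → ℝ) : HasAllMoments (hermiteSum Y s k c) μ :=
  HasAllMoments.sum _ fun m _ => (hY.hasAllMoments_realHermite k m).const_mul _

lemma integral_realHermite_succ (hY : IsStdGaussianProcess Y r μ) (k : ℕ) (t : T) :
    ∫ ω, (realHermite (k + 1)).eval (Y t ω) ∂μ = 0 := by
  have h := integral_X_mul_sub_derivative_gaussianReal (realHermite k)
  rw [← realHermite_succ, ← hY.map_eq t, integral_map (hY.gauss.aemeasurable t)] at h
  · exact h
  · exact (realHermite (k + 1)).continuous.aestronglyMeasurable

/-- Orthogonality of Hermite polynomials of jointly Gaussian variables. -/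
lemma integral_realHermite_mul [Countable T] (hY : IsStdGaussianProcess Y r μ) (n m : T)
    (k j : ℕ) :
    ∫ ω, (realHermite k).eval (Y n ω) * (realHermite j).eval (Y m ω) ∂μ =
      if k = j then (k.factorial : ℝ) * r n m ^ k else 0 := by
  induction k generalizing j with
  | zero =>
    cases j with
    | zero => simp
    | succ j => simpa using hY.integral_realHermite_succ j m
  | succ k ih =>
    cases j with
    | zero => simpa using hY.integral_realHermite_succ k n
    | succ j =>
      have h := hY.integral_realHermite_mul_pow n {m} (fun _ => 1) k j 0
      simp only [Finset.sum_singleton, one_mul, zero_add, pow_one, pow_zero, mul_one, ih,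
        Nat.cast_zero] at h
      rw [h]
      by_cases hkj : k = j
      · subst hkj
        simp only [if_true, Nat.factorial_succ]
        push_cast
        ring
      · simp [hkj]

lemma integral_hermiteSum_mul_of_ne [Countable T] (hY : IsStdGaussianProcess Y r μ) (s : Finset T)
    {k j : ℕ} (hkj : k ≠ j) (c d : T → ℝ) :
    ∫ ω, hermiteSum Y s k c ω * hermiteSum Y s j d ω ∂μ = 0 := by
  simp only [hermiteSum, Finset.sum_mul_sum]
  have h : ∀ n m, Integrable (fun ω => c n * (realHermite k).eval (Y n ω) *
      (d m * (realHermite j).eval (Y m ω))) μ := fun n m =>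
    (((hY.hasAllMoments_realHermite k n).const_mul _).mul
      ((hY.hasAllMoments_realHermite j m).const_mul _)).integrable
  rw [integral_finsetSum _ fun n _ => integrable_finsetSum _ fun m _ => h n m]
  refine Finset.sum_eq_zero fun n _ => ?_
  rw [integral_finsetSum _ fun m _ => h n m]
  refine Finset.sum_eq_zero fun m _ => ?_
  have := hY.integral_realHermite_mul n m k j
  rw [if_neg hkj] at this
  rw [← mul_zero (c n * d m), ← this, ← integral_const_mul]
  congr 1; ext ω; ring

lemma integral_hermiteSum_sq [Countable T] (hY : IsStdGaussianProcess Y r μ) (s : Finset T)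
    (k : ℕ) (c : T → ℝ) :
    ∫ ω, hermiteSum Y s k c ω ^ 2 ∂μ =
      k.factorial * ∑ n ∈ s, ∑ m ∈ s, c n * c m * r n m ^ k := by
  simp only [hermiteSum, sq, Finset.sum_mul_sum]
  have h : ∀ n m, Integrable (fun ω => c n * (realHermite k).eval (Y n ω) *
      (c m * (realHermite k).eval (Y m ω))) μ := fun n m =>
    (((hY.hasAllMoments_realHermite k n).const_mul _).mul
      ((hY.hasAllMoments_realHermite k m).const_mul _)).integrable
  rw [integral_finsetSum _ fun n _ => integrable_finsetSum _ fun m _ => h n m, Finset.mul_sum]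
  refine Finset.sum_congr rfl fun n _ => ?_
  rw [integral_finsetSum _ fun m _ => h n m, Finset.mul_sum]
  refine Finset.sum_congr rfl fun m _ => ?_
  have := hY.integral_realHermite_mul n m k k
  rw [if_pos rfl] at this
  rw [show (k.factorial : ℝ) * (c n * c m * r n m ^ k) =
    c n * c m * ((k.factorial : ℝ) * r n m ^ k) by ring, ← this, ← integral_const_mul]
  congr 1; ext ω; ring

/-- The eighth moment of a sum of Hermite polynomials of degree `k`, after one integration by
parts: the quadratic form in the Hermite polynomials of degree `k` that appears is a sum of squares,
because the correlation matrix is a Gram matrix. -/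
lemma integral_hermiteSum_succ_pow_eight [Countable T] (hY : IsStdGaussianProcess Y r μ)
    (s : Finset T) (k : ℕ) (c : T → ℝ) {d : ℕ} (A : Fin d → T → ℝ)
    (hA : ∀ n ∈ s, ∀ m ∈ s, r n m = ∑ i, A i n * A i m) :
    ∫ ω, hermiteSum Y s (k + 1) c ω ^ 8 ∂μ = 7 * (k + 1) * ∑ i,
      ∫ ω, hermiteSum Y s (k + 1) c ω ^ 6 * hermiteSum Y s k (fun n => c n * A i n) ω ^ 2 ∂μ := by
  set F := hermiteSum Y s (k + 1) c with hF
  have hFm : HasAllMoments F μ := hY.hasAllMoments_hermiteSum s (k + 1) c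
  have hH := hY.hasAllMoments_realHermite
  have h1 : ∀ ω, F ω ^ 8 = ∑ n ∈ s, c n * ((realHermite (k + 1)).eval (Y n ω) * F ω ^ (6 + 1)) := by
    intro ω
    rw [show F ω ^ 8 = F ω * F ω ^ (6 + 1) by ring]
    nth_rewrite 1 [hF]
    rw [hermiteSum, Finset.sum_mul]
    exact Finset.sum_congr rfl fun n _ => by ring
  have h2 : ∀ n, ∫ ω, (realHermite (k + 1)).eval (Y n ω) * F ω ^ (6 + 1) ∂μ =
      7 * (k + 1) * ∑ m ∈ s, r n m * c m *
        ∫ ω, (realHermite k).eval (Y n ω) * (realHermite k).eval (Y m ω) * F ω ^ 6 ∂μ := by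
    intro n
    refine (hY.integral_realHermite_mul_pow n s c k k 6).trans ?_
    norm_num
    left; rfl
  have h3 : ∀ i, ∫ ω, F ω ^ 6 * hermiteSum Y s k (fun n => c n * A i n) ω ^ 2 ∂μ =
      ∑ n ∈ s, ∑ m ∈ s, c n * A i n * (c m * A i m) *
        ∫ ω, (realHermite k).eval (Y n ω) * (realHermite k).eval (Y m ω) * F ω ^ 6 ∂μ := by
    intro i
    have hi : ∀ n m, Integrable (fun ω => c n * A i n * (c m * A i m) *
        ((realHermite k).eval (Y n ω) * (realHermite k).eval (Y m ω) * F ω ^ 6)) μ := fun n m =>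
      ((((hH k n).mul (hH k m)).mul (hFm.pow 6)).const_mul _).integrable
    simp only [← integral_const_mul]
    have : ∀ ω, F ω ^ 6 * hermiteSum Y s k (fun n => c n * A i n) ω ^ 2 =
        ∑ n ∈ s, ∑ m ∈ s, c n * A i n * (c m * A i m) *
          ((realHermite k).eval (Y n ω) * (realHermite k).eval (Y m ω) * F ω ^ 6) := by
      intro ω
      rw [hermiteSum, sq (∑ n ∈ s, _), Finset.sum_mul_sum]
      simp only [Finset.mul_sum]
      exact Finset.sum_congr rfl fun n _ => Finset.sum_congr rfl fun m _ => by ring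
    simp only [this]
    rw [integral_finsetSum _ fun n _ => integrable_finsetSum _ fun m _ => hi n m]
    exact Finset.sum_congr rfl fun n _ => integral_finsetSum _ fun m _ => hi n m
  simp only [h1, h3]
  rw [integral_finsetSum _ fun n _ =>
    (((hH (k + 1) n).mul (hFm.pow (6 + 1))).const_mul (c n)).integrable]
  simp only [integral_const_mul, h2]
  rw [Finset.sum_comm, Finset.mul_sum]
  refine Finset.sum_congr rfl fun n hn => ?_
  rw [Finset.sum_comm, Finset.mul_sum, Finset.mul_sum, Finset.mul_sum]
  refine Finset.sum_congr rfl fun m hm => ?_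
  rw [← Finset.sum_mul, hA n hn m hm]
  have : ∑ i, c n * A i n * (c m * A i m) = c n * c m * ∑ i, A i n * A i m := by
    rw [Finset.mul_sum]
    exact Finset.sum_congr rfl fun i _ => by ring
  rw [this]
  ring

lemma sum_integral_hermiteSum_sq [Countable T] (hY : IsStdGaussianProcess Y r μ)
    (s : Finset T) (k : ℕ) (c : T → ℝ) {d : ℕ} (A : Fin d → T → ℝ)
    (hA : ∀ n ∈ s, ∀ m ∈ s, r n m = ∑ i, A i n * A i m) :
    (k + 1) * ∑ i, ∫ ω, hermiteSum Y s k (fun n => c n * A i n) ω ^ 2 ∂μ =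
      ∫ ω, hermiteSum Y s (k + 1) c ω ^ 2 ∂μ := by
  simp only [hY.integral_hermiteSum_sq]
  rw [← Finset.mul_sum, Nat.factorial_succ, ← mul_assoc]
  push_cast
  congr 1
  rw [Finset.sum_comm]
  refine Finset.sum_congr rfl fun n hn => ?_
  rw [Finset.sum_comm]
  refine Finset.sum_congr rfl fun m hm => ?_
  rw [pow_succ, hA n hn m hm, Finset.mul_sum, Finset.mul_sum]
  exact Finset.sum_congr rfl fun i _ => by ring

/-- Hypercontractivity: for sums of Hermite polynomials of degree `k`,
`‖F‖₈² ≤ 7 ^ k ‖F‖₂²`. The proof is by induction on `k`, integrating by parts once and applying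
Hölder's inequality to each `∫ F⁶ S²`. -/
theorem integral_hermiteSum_pow_eight_le [Countable T] (hY : IsStdGaussianProcess Y r μ)
    (s : Finset T) (k : ℕ) (c : T → ℝ) :
    ∫ ω, hermiteSum Y s k c ω ^ 8 ∂μ ≤ (7 ^ k * ∫ ω, hermiteSum Y s k c ω ^ 2 ∂μ) ^ 4 := by
  induction k generalizing c with
  | zero =>
    simp only [hermiteSum, realHermite_zero, Polynomial.eval_one, integral_const, probReal_univ]
    apply le_of_eq
    simp only [smul_eq_mul]
    ring
  | succ k ih =>
    obtain ⟨d, A, hA⟩ := hY.exists_gram s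
    have hM := hY.integral_hermiteSum_succ_pow_eight s k c A hA
    have hE := hY.sum_integral_hermiteSum_sq s k c A hA
    have hFm := hY.hasAllMoments_hermiteSum s (k + 1) c
    set F := hermiteSum Y s (k + 1) c
    set S := fun i => hermiteSum Y s k (fun n => c n * A i n)
    have hSm : ∀ i, HasAllMoments (S i) μ := fun i => hY.hasAllMoments_hermiteSum s k _
    set M := ∫ ω, F ω ^ 8 ∂μ
    have hM0 : 0 ≤ M := integral_nonneg fun ω => by positivity
    -- `m = ‖F‖₈²`, so that Hölder's inequality reads `∫ F⁶ S² ≤ m³ ‖S‖₈²`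
    set m := √√M
    have hm0 : 0 ≤ m := Real.sqrt_nonneg _
    have hm4 : m ^ 4 = M := by
      rw [show m ^ 4 = (m ^ 2) ^ 2 by ring, Real.sq_sqrt (Real.sqrt_nonneg _), Real.sq_sqrt hM0]
    have hS0 : ∀ i, 0 ≤ 7 ^ k * ∫ ω, S i ω ^ 2 ∂μ := fun i =>
      mul_nonneg (by positivity) (integral_nonneg fun ω => by positivity)
    have hbound : ∀ i, ∫ ω, F ω ^ 6 * S i ω ^ 2 ∂μ ≤ m ^ 3 * (7 ^ k * ∫ ω, S i ω ^ 2 ∂μ) := by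
      intro i
      -- Hölder with exponents `4 / 3` and `4`, as Cauchy–Schwarz applied twice
      have c1 := (hFm.pow 4).sq_integral_mul_le ((hFm.pow 2).mul ((hSm i).pow 2))
      have c2 := (hFm.pow 4).sq_integral_mul_le ((hSm i).pow 4)
      have e1 : ∀ ω, F ω ^ 4 * (F ω ^ 2 * S i ω ^ 2) = F ω ^ 6 * S i ω ^ 2 := fun ω => by ring
      have e2 : ∀ ω, (F ω ^ 4) ^ 2 = F ω ^ 8 := fun ω => by ring
      have e3 : ∀ ω, (F ω ^ 2 * S i ω ^ 2) ^ 2 = F ω ^ 4 * S i ω ^ 4 := fun ω => by ring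
      have e4 : ∀ ω, (S i ω ^ 4) ^ 2 = S i ω ^ 8 := fun ω => by ring
      simp only [e1, e2, e3] at c1
      simp only [e2, e4] at c2
      have hih := ih (fun n => c n * A i n)
      have hpow : (∫ ω, F ω ^ 6 * S i ω ^ 2 ∂μ) ^ 4 ≤
          (m ^ 3 * (7 ^ k * ∫ ω, S i ω ^ 2 ∂μ)) ^ 4 := by
        calc (∫ ω, F ω ^ 6 * S i ω ^ 2 ∂μ) ^ 4
            = ((∫ ω, F ω ^ 6 * S i ω ^ 2 ∂μ) ^ 2) ^ 2 := by ring
          _ ≤ (M * ∫ ω, F ω ^ 4 * S i ω ^ 4 ∂μ) ^ 2 := by gcongr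
          _ = M ^ 2 * (∫ ω, F ω ^ 4 * S i ω ^ 4 ∂μ) ^ 2 := by ring
          _ ≤ M ^ 2 * (M * ∫ ω, S i ω ^ 8 ∂μ) := by gcongr
          _ ≤ M ^ 2 * (M * (7 ^ k * ∫ ω, S i ω ^ 2 ∂μ) ^ 4) := by gcongr
          _ = _ := by rw [← hm4]; ring
      exact le_of_pow_le_pow_left₀ (by norm_num) (mul_nonneg (by positivity) (hS0 i)) hpow
    have hfin : m ^ 3 * m ≤ m ^ 3 * (7 ^ (k + 1) * ∫ ω, F ω ^ 2 ∂μ) := by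
      calc m ^ 3 * m = M := by rw [← hm4]; ring
        _ ≤ 7 * (k + 1) * ∑ i, m ^ 3 * (7 ^ k * ∫ ω, S i ω ^ 2 ∂μ) := by
            rw [hM]
            gcongr with i
            exact hbound i
        _ = _ := by
            rw [← hE, ← Finset.mul_sum, ← Finset.mul_sum]
            ring
    have hE0 : 0 ≤ ∫ ω, F ω ^ 2 ∂μ := integral_nonneg fun ω => by positivity
    have hm : m ≤ 7 ^ (k + 1) * ∫ ω, F ω ^ 2 ∂μ := by
      rcases hm0.eq_or_lt with h | h
      · rw [← h]; positivity
      · exact le_of_mul_le_mul_left hfin (by positivity)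
    rw [← hm4]
    gcongr

end IsStdGaussianProcess

/-! ### Expansion of the kurtosis ratio -/

/-- The pointwise expansion behind the mean. For `|u| > 1/2` the bound `b ≤ N` is used, together
with `1 ≤ (2u)^8`. -/
lemma abs_ratio_sub_linear_le {u v b N : ℝ} (hN : 1 ≤ N) (hu : 0 < 1 + u) (hb0 : 0 ≤ b)
    (hbN : b ≤ N) (hb : b - 3 = (v - 3 * u ^ 2) / (1 + u) ^ 2) :
    |b - 3 - (v - 3 * u ^ 2 - 2 * (u * v))| ≤
      16 * (|v| * u ^ 2) + 30 * |u| ^ 3 + 1024 * (N * u ^ 8) := by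
  have hNu : 0 ≤ N * u ^ 8 := by positivity
  by_cases h : |u| ≤ 1 / 2
  · obtain ⟨h1, h2⟩ := abs_le.1 h
    set w := (1 + u)⁻¹ with hw
    have hw0 : 0 < w := inv_pos.2 hu
    have hwu : w * (1 + u) = 1 := inv_mul_cancel₀ hu.ne'
    have hw2 : w ≤ 2 := by nlinarith
    have hw4 : w ^ 2 ≤ 4 := by nlinarith
    have hwu2 : w ^ 2 * (1 + u) ^ 2 = 1 := by rw [← mul_pow, hwu, one_pow]
    have e : b - 3 - (v - 3 * u ^ 2 - 2 * (u * v)) =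
        v * u ^ 2 * (w ^ 2 * (3 + 2 * u)) + u ^ 3 * (w ^ 2 * (3 * (2 + u))) := by
      have : b - 3 = (v - 3 * u ^ 2) * w ^ 2 := by rw [hb, hw, inv_pow, div_eq_mul_inv]
      rw [this]
      linear_combination (v * (1 - 2 * u) - 3 * u ^ 2) * hwu2
    have b1 : |w ^ 2 * (3 + 2 * u)| ≤ 16 := by
      rw [abs_of_nonneg (by nlinarith [sq_nonneg w])]
      nlinarith [sq_nonneg w]
    have b2 : |w ^ 2 * (3 * (2 + u))| ≤ 30 := by
      rw [abs_of_nonneg (by nlinarith [sq_nonneg w])]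
      nlinarith [sq_nonneg w]
    rw [e]
    calc _ ≤ |v * u ^ 2 * (w ^ 2 * (3 + 2 * u))| + |u ^ 3 * (w ^ 2 * (3 * (2 + u)))| :=
          abs_add_le _ _
      _ = |v| * u ^ 2 * |w ^ 2 * (3 + 2 * u)| + |u| ^ 3 * |w ^ 2 * (3 * (2 + u))| := by
          rw [abs_mul, abs_mul v, abs_mul (u ^ 3), abs_pow u 3, abs_of_nonneg (sq_nonneg u)]
      _ ≤ |v| * u ^ 2 * 16 + |u| ^ 3 * 30 := by gcongr
      _ ≤ _ := by linarith
  · push Not at h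
    have hu2 : 1 ≤ 4 * u ^ 2 := by
      rw [← sq_abs u]; nlinarith
    have hu8 : 1 ≤ 256 * u ^ 8 := by
      calc (1 : ℝ) = 1 ^ 4 := by norm_num
        _ ≤ (4 * u ^ 2) ^ 4 := by gcongr
        _ = _ := by ring
    have c1 : |b - 3| ≤ 4 * N := by rw [abs_le]; constructor <;> linarith
    have c2 : 4 * N ≤ 1024 * (N * u ^ 8) := by nlinarith
    have c3 : |v| ≤ 4 * (|v| * u ^ 2) := by nlinarith [abs_nonneg v]
    have c4 : 3 * u ^ 2 ≤ 6 * |u| ^ 3 := by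
      rw [← sq_abs u]; nlinarith [sq_nonneg |u|]
    have c5 : |u * v| ≤ 2 * (|v| * u ^ 2) := by
      rw [abs_mul, ← sq_abs u]
      nlinarith [mul_nonneg (abs_nonneg v) (abs_nonneg u)]
    have c6 : |v - 3 * u ^ 2 - 2 * (u * v)| ≤ |v| + 3 * u ^ 2 + 2 * |u * v| := by
      rw [abs_le]
      have := neg_abs_le v
      have := le_abs_self v
      have := neg_abs_le (u * v)
      have := le_abs_self (u * v)
      have := sq_nonneg u
      constructor <;> linarith
    have c7 := abs_sub (b - 3) (v - 3 * u ^ 2 - 2 * (u * v))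
    have c8 : 0 ≤ |v| * u ^ 2 := by positivity
    have c9 : 0 ≤ |u| ^ 3 := by positivity
    linarith

/-- The pointwise expansion behind the variance. For `|u| > 1/2` the bound `b ≤ N` is used, together
with `1 ≤ (2u)^8`. -/
lemma abs_ratio_sq_sub_sq_le {u v b N : ℝ} (hN : 1 ≤ N) (hu : 0 < 1 + u) (hb0 : 0 ≤ b)
    (hbN : b ≤ N) (hb : b - 3 = (v - 3 * u ^ 2) / (1 + u) ^ 2) :
    |(b - 3) ^ 2 - v ^ 2| ≤
      160 * (v ^ 2 * |u|) + 96 * (|v| * u ^ 2) + 144 * u ^ 4 + 4096 * (N ^ 2 * u ^ 8) := by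
  have hNu : 0 ≤ N ^ 2 * u ^ 8 := by positivity
  by_cases h : |u| ≤ 1 / 2
  · obtain ⟨h1, h2⟩ := abs_le.1 h
    set w := (1 + u)⁻¹ with hw
    have hw0 : 0 < w := inv_pos.2 hu
    have hwu : w * (1 + u) = 1 := inv_mul_cancel₀ hu.ne'
    have hw2 : w ≤ 2 := by nlinarith
    have hw4 : w ^ 2 ≤ 4 := by nlinarith
    have hw16 : w ^ 4 ≤ 16 := by nlinarith [sq_nonneg w]
    have hwu4 : w ^ 4 * (1 + u) ^ 4 = 1 := by rw [← mul_pow, hwu, one_pow]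
    have e : (b - 3) ^ 2 - v ^ 2 = v ^ 2 * u * (w ^ 4 * -((2 + u) * (2 + 2 * u + u ^ 2))) +
        v * u ^ 2 * (w ^ 4 * (-6)) + u ^ 4 * (w ^ 4 * 9) := by
      have : b - 3 = (v - 3 * u ^ 2) * w ^ 2 := by rw [hb, hw, inv_pow, div_eq_mul_inv]
      rw [this]
      linear_combination v ^ 2 * hwu4
    have b1 : |w ^ 4 * -((2 + u) * (2 + 2 * u + u ^ 2))| ≤ 160 := by
      have q0 : 0 ≤ (2 + u) * (2 + 2 * u + u ^ 2) := by
        have : 0 ≤ 2 + 2 * u + u ^ 2 := by nlinarith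
        have : 0 ≤ 2 + u := by linarith
        positivity
      have q1 : (2 + u) * (2 + 2 * u + u ^ 2) ≤ 10 := by
        have : 0 ≤ 2 + 2 * u + u ^ 2 := by nlinarith
        have : 2 + 2 * u + u ^ 2 ≤ 4 := by nlinarith
        nlinarith
      rw [mul_neg, abs_neg, abs_of_nonneg (by positivity)]
      calc _ ≤ 16 * (10 : ℝ) := by gcongr
        _ = 160 := by norm_num
    have b2 : |w ^ 4 * (-6)| ≤ 96 := by
      rw [abs_mul, abs_of_nonneg (by positivity)]
      norm_num; linarith
    have b3 : w ^ 4 * 9 ≤ 144 := by linarith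
    rw [e]
    calc _ ≤ |v ^ 2 * u * (w ^ 4 * -((2 + u) * (2 + 2 * u + u ^ 2)))| +
            |v * u ^ 2 * (w ^ 4 * (-6))| + |u ^ 4 * (w ^ 4 * 9)| := abs_add_three _ _ _
      _ = v ^ 2 * |u| * |w ^ 4 * -((2 + u) * (2 + 2 * u + u ^ 2))| +
            |v| * u ^ 2 * |w ^ 4 * (-6)| + u ^ 4 * (w ^ 4 * 9) := by
          rw [abs_mul, abs_mul (v ^ 2), abs_mul (v * u ^ 2), abs_mul v, abs_of_nonneg (sq_nonneg u),
            abs_of_nonneg (sq_nonneg v), abs_of_nonneg (a := u ^ 4 * (w ^ 4 * 9)) (by positivity)]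
      _ ≤ v ^ 2 * |u| * 160 + |v| * u ^ 2 * 96 + u ^ 4 * 144 := by gcongr
      _ ≤ _ := by linarith
  · push Not at h
    have hu2 : 1 ≤ 4 * u ^ 2 := by
      rw [← sq_abs u]; nlinarith
    have hu8 : 1 ≤ 256 * u ^ 8 := by
      calc (1 : ℝ) = 1 ^ 4 := by norm_num
        _ ≤ (4 * u ^ 2) ^ 4 := by gcongr
        _ = _ := by ring
    have c1 : (b - 3) ^ 2 ≤ 16 * N ^ 2 := by nlinarith
    have c2 : 16 * N ^ 2 ≤ 4096 * (N ^ 2 * u ^ 8) := by nlinarith [sq_nonneg N]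
    have c3 : v ^ 2 ≤ 2 * (v ^ 2 * |u|) := by nlinarith [sq_nonneg v]
    have c4 : 0 ≤ |v| * u ^ 2 := by positivity
    have c5 : 0 ≤ u ^ 4 := by positivity
    have c6 := sq_nonneg (b - 3)
    have c7 := sq_nonneg v
    rw [abs_le]
    constructor <;> linarith

lemma mul_le_half_young {x y a : ℝ} (ha : 0 < a) : x * y ≤ 1 / 2 * (x ^ 2 / a + a * y ^ 2) := by
  have h : 1 / 2 * (x ^ 2 / a + a * y ^ 2) - x * y = (x - a * y) ^ 2 / (2 * a) := by
    field_simp; ring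
  have : 0 ≤ (x - a * y) ^ 2 / (2 * a) := by positivity
  linarith

/-- If `B - 3 = (V - 3U²) / (1 + U)²` with `0 ≤ B ≤ a²`, and `U`, `V` have the moments of averages
of `a²` weakly dependent variables, then `𝔼 B = 3 - 3 𝔼 U² + O(a⁻³)` and
`Var B = 𝔼 V² + O(a⁻³)`. -/
lemma abs_integral_ratio_le_and_abs_variance_ratio_le {Ω : Type*} [MeasurableSpace Ω]
    {μ : Measure Ω} [IsProbabilityMeasure μ] {U V B : Ω → ℝ} {a K : ℝ} (ha : 1 ≤ a)
    (hU : HasAllMoments U μ) (hV : HasAllMoments V μ) (hB : AEStronglyMeasurable B μ)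
    (hB0 : ∀ ω, 0 ≤ B ω) (hBN : ∀ ω, B ω ≤ a ^ 2)
    (hUB : ∀ᵐ ω ∂μ, 0 < 1 + U ω ∧ B ω - 3 = (V ω - 3 * U ω ^ 2) / (1 + U ω) ^ 2)
    (hV1 : ∫ ω, V ω ∂μ = 0) (hUV : ∫ ω, U ω * V ω ∂μ = 0)
    (hU2 : ∫ ω, U ω ^ 2 ∂μ ≤ K / a ^ 2) (hV2 : ∫ ω, V ω ^ 2 ∂μ ≤ K / a ^ 2)
    (hU4 : ∫ ω, U ω ^ 4 ∂μ ≤ K / a ^ 4) (hV4 : ∫ ω, V ω ^ 4 ∂μ ≤ K / a ^ 4)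
    (hU8 : ∫ ω, U ω ^ 8 ∂μ ≤ K / a ^ 8) :
    |(∫ ω, B ω ∂μ) - 3 + 3 * ∫ ω, U ω ^ 2 ∂μ| ≤ 1070 * K / a ^ 3 ∧
      |Var[B; μ] - ∫ ω, V ω ^ 2 ∂μ| ≤ (4496 * K + (1073 * K) ^ 2) / a ^ 3 := by
  have ha0 : 0 < a := by linarith
  have haN : 1 ≤ a ^ 2 := one_le_pow₀ ha
  have hK : 0 ≤ K := by
    have h0 : 0 ≤ ∫ ω, U ω ^ 2 ∂μ := integral_nonneg fun ω => sq_nonneg _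
    have := (le_div_iff₀ (by positivity)).1 (h0.trans hU2)
    linarith
  have hBm : HasAllMoments B μ := fun p => MemLp.of_bound hB (a ^ 2) (ae_of_all _ fun ω => by
    rw [Real.norm_eq_abs, abs_of_nonneg (hB0 ω)]; exact hBN ω)
  have hB3 : HasAllMoments (fun ω => B ω - 3) μ := hBm.sub (.const 3)
  -- the odd moments are traded for even ones, weighted so that every term becomes `O(a⁻³)`
  have young1 : ∀ u v : ℝ, |v| * u ^ 2 ≤ 1 / 2 * (v ^ 2 / a + a * u ^ 4) := fun u v => by
    have := mul_le_half_young (x := |v|) (y := u ^ 2) ha0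
    rwa [sq_abs, ← pow_mul] at this
  have young2 : ∀ u : ℝ, |u| ^ 3 ≤ 1 / 2 * (u ^ 2 / a + a * u ^ 4) := fun u => by
    have := mul_le_half_young (x := |u|) (y := u ^ 2) ha0
    rw [sq_abs, ← pow_mul] at this
    calc |u| ^ 3 = |u| * |u| ^ 2 := by ring
      _ = |u| * u ^ 2 := by rw [sq_abs]
      _ ≤ _ := this
  have young3 : ∀ u v : ℝ, v ^ 2 * |u| ≤ 1 / 2 * (u ^ 2 / a + a * v ^ 4) := fun u v => by
    have := mul_le_half_young (x := |u|) (y := v ^ 2) ha0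
    rw [sq_abs, ← pow_mul, mul_comm] at this
    exact this
  -- the expansion of the mean
  have hmean : |(∫ ω, B ω ∂μ) - 3 + 3 * ∫ ω, U ω ^ 2 ∂μ| ≤ 1070 * K / a ^ 3 := by
    have e : (∫ ω, B ω ∂μ) - 3 + 3 * ∫ ω, U ω ^ 2 ∂μ =
        ∫ ω, (B ω - 3 - (V ω - 3 * U ω ^ 2 - 2 * (U ω * V ω))) ∂μ := by
      have h1 := hV.sub ((hU.pow 2).const_mul 3)
      have h2 := (hU.mul hV).const_mul 2
      rw [integral_sub hB3.integrable (h1.sub h2).integrable,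
        integral_sub hBm.integrable (HasAllMoments.const 3).integrable,
        integral_sub h1.integrable h2.integrable,
        integral_sub hV.integrable ((hU.pow 2).const_mul 3).integrable, integral_const_mul,
        integral_const_mul, hV1, hUV]
      simp
    rw [e]
    refine (abs_integral_le_integral_abs).trans ?_
    have hle : ∀ᵐ ω ∂μ, |B ω - 3 - (V ω - 3 * U ω ^ 2 - 2 * (U ω * V ω))| ≤
        8 / a * V ω ^ 2 + 15 / a * U ω ^ 2 + 23 * a * U ω ^ 4 + 1024 * a ^ 2 * U ω ^ 8 := by
      filter_upwards [hUB] with ω hω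
      refine (abs_ratio_sub_linear_le haN hω.1 (hB0 ω) (hBN ω) hω.2).trans ?_
      have y1 := young1 (U ω) (V ω)
      have y2 := young2 (U ω)
      rw [div_mul_eq_mul_div, div_mul_eq_mul_div, mul_div_assoc, mul_div_assoc]
      linarith
    have i1 := (hV.pow 2).const_mul (8 / a)
    have i2 := (hU.pow 2).const_mul (15 / a)
    have i3 := (hU.pow 4).const_mul (23 * a)
    have i4 := (hU.pow 8).const_mul (1024 * a ^ 2)
    refine (integral_mono_ae (hB3.sub ((hV.sub ((hU.pow 2).const_mul 3)).sub
      ((hU.mul hV).const_mul 2))).abs.integrable (((i1.add i2).add i3).add i4).integrable hle).trans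
      ?_
    rw [integral_add ((i1.add i2).add i3).integrable i4.integrable,
      integral_add (i1.add i2).integrable i3.integrable, integral_add i1.integrable i2.integrable]
    simp only [integral_const_mul]
    calc _ ≤ 8 / a * (K / a ^ 2) + 15 / a * (K / a ^ 2) + 23 * a * (K / a ^ 4) +
          1024 * a ^ 2 * (K / a ^ 8) := by gcongr
      _ = 46 * K / a ^ 3 + 1024 * K / a ^ 6 := by field_simp; ring
      _ ≤ 46 * K / a ^ 3 + 1024 * K / a ^ 3 := by gcongr; norm_num
      _ = _ := by ring
  refine ⟨hmean, ?_⟩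
  -- the expansion of the second moment about `3`
  have hsq : |(∫ ω, (B ω - 3) ^ 2 ∂μ) - ∫ ω, V ω ^ 2 ∂μ| ≤ 4496 * K / a ^ 3 := by
    rw [← integral_sub (hB3.pow 2).integrable (hV.pow 2).integrable]
    refine (abs_integral_le_integral_abs).trans ?_
    have hle : ∀ᵐ ω ∂μ, |(B ω - 3) ^ 2 - V ω ^ 2| ≤
        80 / a * U ω ^ 2 + 80 * a * V ω ^ 4 + 48 / a * V ω ^ 2 + (48 * a + 144) * U ω ^ 4 +
          4096 * (a ^ 2) ^ 2 * U ω ^ 8 := by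
      filter_upwards [hUB] with ω hω
      refine (abs_ratio_sq_sub_sq_le haN hω.1 (hB0 ω) (hBN ω) hω.2).trans ?_
      have y1 := young1 (U ω) (V ω)
      have y3 := young3 (U ω) (V ω)
      rw [div_mul_eq_mul_div, div_mul_eq_mul_div, mul_div_assoc, mul_div_assoc]
      linarith
    have i1 := (hU.pow 2).const_mul (80 / a)
    have i2 := (hV.pow 4).const_mul (80 * a)
    have i3 := (hV.pow 2).const_mul (48 / a)
    have i4 := (hU.pow 4).const_mul (48 * a + 144)
    have i5 := (hU.pow 8).const_mul (4096 * (a ^ 2) ^ 2)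
    refine (integral_mono_ae ((hB3.pow 2).sub (hV.pow 2)).abs.integrable
      ((((i1.add i2).add i3).add i4).add i5).integrable hle).trans ?_
    rw [integral_add (((i1.add i2).add i3).add i4).integrable i5.integrable,
      integral_add ((i1.add i2).add i3).integrable i4.integrable,
      integral_add (i1.add i2).integrable i3.integrable, integral_add i1.integrable i2.integrable]
    simp only [integral_const_mul]
    calc _ ≤ 80 / a * (K / a ^ 2) + 80 * a * (K / a ^ 4) + 48 / a * (K / a ^ 2) +
          (48 * a + 144) * (K / a ^ 4) + 4096 * (a ^ 2) ^ 2 * (K / a ^ 8) := by gcongr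
      _ = 256 * K / a ^ 3 + 144 * K / a ^ 4 + 4096 * K / a ^ 4 := by field_simp; ring
      _ ≤ 256 * K / a ^ 3 + 144 * K / a ^ 3 + 4096 * K / a ^ 3 := by gcongr <;> norm_num
      _ = _ := by ring
  have hm : |(∫ ω, B ω ∂μ) - 3| ≤ 1073 * K / a ^ 2 := by
    have h0 : 0 ≤ ∫ ω, U ω ^ 2 ∂μ := integral_nonneg fun ω => sq_nonneg _
    have h1 : 1070 * K / a ^ 3 ≤ 1070 * K / a ^ 2 := by gcongr; norm_num
    have h2 : 1073 * K / a ^ 2 = 1070 * K / a ^ 2 + 3 * (K / a ^ 2) := by ring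
    rw [abs_le] at hmean ⊢
    constructor <;> linarith
  have hm2 : ((∫ ω, B ω ∂μ) - 3) ^ 2 ≤ (1073 * K) ^ 2 / a ^ 3 := by
    rw [← sq_abs]
    calc _ ≤ (1073 * K / a ^ 2) ^ 2 := by gcongr
      _ = (1073 * K) ^ 2 / a ^ 4 := by rw [div_pow, ← pow_mul]
      _ ≤ _ := by gcongr; norm_num
  have hvar : Var[B; μ] = (∫ ω, (B ω - 3) ^ 2 ∂μ) - ((∫ ω, B ω ∂μ) - 3) ^ 2 := by
    rw [← variance_sub_const hB 3, variance_eq_sub hB3.memLp_two,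
      integral_sub hBm.integrable (integrable_const _)]
    simp
  rw [hvar, add_div]
  have := sq_nonneg ((∫ ω, B ω ∂μ) - 3)
  rw [abs_le] at hsq ⊢
  constructor <;> linarith

/-! ### Moments of sample averages of Hermite polynomials -/

/-- Summation of a function of the lag over a square of indices. -/
lemma sum_sum_lag (f : ℕ → ℝ) (N : ℕ) :
    ∑ n ∈ Finset.Icc 1 N, ∑ m ∈ Finset.Icc 1 N, f ((n - m) + (m - n)) =
      N * f 0 + 2 * ∑ τ ∈ Finset.Ico 1 N, ((N : ℝ) - τ) * f τ := by
  induction N with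
  | zero => simp
  | succ N ih =>
    have hrefl : ∑ n ∈ Finset.Icc 1 N, f (N + 1 - n) = ∑ τ ∈ Finset.Icc 1 N, f τ := by
      refine Finset.sum_nbij' (fun n => N + 1 - n) (fun n => N + 1 - n) ?_ ?_ ?_ ?_ fun _ _ => rfl
        <;> intro n hn <;> rw [Finset.mem_Icc] at hn
      · exact Finset.mem_Icc.2 ⟨by omega, by omega⟩
      · exact Finset.mem_Icc.2 ⟨by omega, by omega⟩
      · exact Nat.sub_sub_self (by omega)
      · exact Nat.sub_sub_self (by omega)
    have h1 : ∀ n ∈ Finset.Icc 1 N, f ((n - (N + 1)) + (N + 1 - n)) = f (N + 1 - n) := by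
      intro n hn
      rw [Finset.mem_Icc] at hn
      congr 1; omega
    have h2 : ∀ n ∈ Finset.Icc 1 N, f ((N + 1 - n) + (n - (N + 1))) = f (N + 1 - n) := by
      intro n hn
      rw [Finset.mem_Icc] at hn
      congr 1; omega
    have h3 : ∑ τ ∈ Finset.Ico 1 (N + 1), (((N + 1 : ℕ) : ℝ) - τ) * f τ =
        ∑ τ ∈ Finset.Ico 1 N, ((N : ℝ) - τ) * f τ + ∑ τ ∈ Finset.Icc 1 N, f τ := by
      have h4 : ∑ τ ∈ Finset.Ico 1 (N + 1), ((N : ℝ) - τ) * f τ =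
          ∑ τ ∈ Finset.Ico 1 N, ((N : ℝ) - τ) * f τ := by
        rcases N.eq_zero_or_pos with rfl | hN
        · simp
        · rw [Finset.sum_Ico_succ_top hN]; simp
      have h5 : Finset.Icc 1 N = Finset.Ico 1 (N + 1) := by ext; simp
      rw [← h4, h5, ← Finset.sum_add_distrib]
      refine Finset.sum_congr rfl fun τ _ => ?_
      push_cast; ring
    rw [Finset.sum_Icc_succ_top (by omega), Finset.sum_Icc_succ_top (by omega), h3]
    simp only [Finset.sum_Icc_succ_top (show 1 ≤ N + 1 by omega), Finset.sum_add_distrib]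
    rw [ih, Finset.sum_congr rfl h1, Finset.sum_congr rfl h2, hrefl]
    simp
    ring

namespace IsStdGaussianProcess

variable {Ω T : Type*} [MeasurableSpace Ω] {Y : T → Ω → ℝ} {r : T → T → ℝ} {μ : Measure Ω}
  [IsProbabilityMeasure μ]

lemma corr_sq_le_one (hY : IsStdGaussianProcess Y r μ) (s t : T) : r s t ^ 2 ≤ 1 := by
  have h := (hY.hasAllMoments s).sq_integral_mul_le (hY.hasAllMoments t)
  simp only [sq (Y _ _), hY.corr, hY.diag] at h
  linarith

lemma integral_hermiteSum_succ (hY : IsStdGaussianProcess Y r μ) (s : Finset T) (k : ℕ)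
    (c : T → ℝ) : ∫ ω, hermiteSum Y s (k + 1) c ω ∂μ = 0 := by
  simp only [hermiteSum]
  rw [integral_finsetSum _ fun n _ =>
    ((hY.hasAllMoments_realHermite (k + 1) n).const_mul (c n)).integrable]
  simp [integral_const_mul, hY.integral_realHermite_succ]

/-- The fourth moment is controlled by the eighth, hence by the second. -/
lemma integral_hermiteSum_pow_four_le [Countable T] (hY : IsStdGaussianProcess Y r μ)
    (s : Finset T) (k : ℕ) (c : T → ℝ) :
    ∫ ω, hermiteSum Y s k c ω ^ 4 ∂μ ≤ (7 ^ k * ∫ ω, hermiteSum Y s k c ω ^ 2 ∂μ) ^ 2 := by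
  have h8 := hY.integral_hermiteSum_pow_eight_le s k c
  have h4 := ((hY.hasAllMoments_hermiteSum s k c).pow 4).sq_integral_mul_le (.const 1)
  simp only [mul_one, ← pow_mul, one_pow, integral_const, probReal_univ, smul_eq_mul] at h4
  norm_num at h4
  refine le_of_pow_le_pow_left₀ (n := 2) two_ne_zero (by positivity) ?_
  calc _ ≤ _ := h4
    _ ≤ _ := h8
    _ = _ := by ring

/-- By hypercontractivity a second moment of order `1 / N` forces fourth and eighth moments of
orders `1 / N²` and `1 / N⁴`; the three bounds share one constant. -/
lemma integral_hermiteSum_pow_le_of_sq_le [Countable T] (hY : IsStdGaussianProcess Y r μ)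
    (s : Finset T) (k : ℕ) (c : T → ℝ) {K N : ℝ} (hK : 1 ≤ K) (hN : 0 < N)
    (h : 7 ^ k * ∫ ω, hermiteSum Y s k c ω ^ 2 ∂μ ≤ K / N) :
    ∫ ω, hermiteSum Y s k c ω ^ 2 ∂μ ≤ K ^ 4 / N ∧
      ∫ ω, hermiteSum Y s k c ω ^ 4 ∂μ ≤ K ^ 4 / N ^ 2 ∧
      ∫ ω, hermiteSum Y s k c ω ^ 8 ∂μ ≤ K ^ 4 / N ^ 4 := by
  have h0 : 0 ≤ ∫ ω, hermiteSum Y s k c ω ^ 2 ∂μ := integral_nonneg fun ω => sq_nonneg _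
  have h7 : (1 : ℝ) ≤ 7 ^ k := one_le_pow₀ (by norm_num)
  refine ⟨?_, ?_, ?_⟩
  · calc _ ≤ 7 ^ k * ∫ ω, hermiteSum Y s k c ω ^ 2 ∂μ := le_mul_of_one_le_left h0 h7
      _ ≤ K / N := h
      _ ≤ K ^ 4 / N := by
        gcongr
        exact le_self_pow₀ hK (by norm_num)
  · calc _ ≤ _ := hY.integral_hermiteSum_pow_four_le s k c
      _ ≤ (K / N) ^ 2 := pow_le_pow_left₀ (by positivity) h 2
      _ = K ^ 2 / N ^ 2 := div_pow _ _ _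
      _ ≤ K ^ 4 / N ^ 2 := by
        gcongr
        norm_num
  · calc _ ≤ _ := hY.integral_hermiteSum_pow_eight_le s k c
      _ ≤ (K / N) ^ 4 := pow_le_pow_left₀ (by positivity) h 4
      _ = K ^ 4 / N ^ 4 := div_pow _ _ _

end IsStdGaussianProcess

/-! ### The sample kurtosis of a stationary Gaussian process -/

lemma sampleVar_nonneg {Ω : Type*} {X : ℕ → Ω → ℝ} (N : ℕ) (ω : Ω) : 0 ≤ sampleVar X N ω :=
  mul_nonneg (by positivity) (Finset.sum_nonneg fun _ _ => mul_self_nonneg _)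

lemma sampleKurtosis_nonneg {Ω : Type*} {X : ℕ → Ω → ℝ} (N : ℕ) (ω : Ω) : 0 ≤ sampleKurtosis X N ω :=
  mul_nonneg (by positivity) (Finset.sum_nonneg fun _ _ => sq_nonneg _)

/-- The sample kurtosis never exceeds the sample size, as `∑ x⁴ ≤ (∑ x²)²`. Where the sample
variance vanishes, so does the sample kurtosis. -/
lemma sampleKurtosis_le {Ω : Type*} {X : ℕ → Ω → ℝ} {N : ℕ} (hN : 1 ≤ N) (ω : Ω) :
    sampleKurtosis X N ω ≤ N := by
  have hN0 : (0 : ℝ) < N := by exact_mod_cast hN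
  have hw : ∀ n ∈ Finset.Icc 1 N, 0 ≤ X n ω * (sampleVar X N ω)⁻¹ * X n ω := fun n _ => by
    rw [mul_right_comm]
    exact mul_nonneg (mul_self_nonneg _) (inv_nonneg.2 (sampleVar_nonneg N ω))
  have hsum : ∑ n ∈ Finset.Icc 1 N, X n ω * (sampleVar X N ω)⁻¹ * X n ω ≤ N := by
    have e : ∑ n ∈ Finset.Icc 1 N, X n ω * (sampleVar X N ω)⁻¹ * X n ω =
        N * (sampleVar X N ω * (sampleVar X N ω)⁻¹) := by
      conv_rhs => rw [← mul_assoc]; enter [1, 2]; rw [sampleVar]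
      rw [← mul_assoc, mul_one_div_cancel hN0.ne', one_mul, Finset.sum_mul]
      exact Finset.sum_congr rfl fun n _ => by ring
    rw [e]
    exact mul_le_of_le_one_right hN0.le mul_inv_le_one
  rw [sampleKurtosis, one_div, inv_mul_le_iff₀ hN0, ← sq]
  calc _ ≤ (∑ n ∈ Finset.Icc 1 N, X n ω * (sampleVar X N ω)⁻¹ * X n ω) ^ 2 :=
        Finset.sum_sq_le_sq_sum_of_nonneg hw
    _ ≤ _ := by
        have := Finset.sum_nonneg hw
        gcongr

section

variable {Ω : Type*} [MeasurableSpace Ω] {μ : Measure Ω} {X : ℕ → Ω → ℝ}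

lemma covariance_eq_autocov_lag (hstat : IsWideSenseStationary X μ) (n m : ℕ) :
    cov[X n, X m; μ] = autocov X μ ((n - m) + (m - n)) := by
  rcases le_total n m with h | h
  · obtain ⟨t, rfl⟩ := Nat.exists_eq_add_of_le h
    rw [hstat.cov_eq, autocov]
    congr 2; omega
  · obtain ⟨t, rfl⟩ := Nat.exists_eq_add_of_le h
    rw [covariance_comm, hstat.cov_eq, autocov]
    congr 2; omega

lemma aestronglyMeasurable_sampleKurtosis (hgauss : IsGaussianProcess X μ) (N : ℕ) :
    AEStronglyMeasurable (sampleKurtosis X N) μ := by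
  have h := hgauss.aemeasurable
  refine AEMeasurable.aestronglyMeasurable ?_
  unfold sampleKurtosis sampleVar
  fun_prop

/-- The kurtosis in terms of the averages `U`, `V` of the second and fourth Hermite polynomials of
the standardised process. -/
lemma sampleKurtosis_sub_three_eq (hpos : 0 < autocov X μ 0) {N : ℕ} (hN : 1 ≤ N) {ω : Ω}
    (hω : 0 < sampleVar X N ω) {U V : ℝ}
    (hU : U = hermiteSum (fun n ω => (√(autocov X μ 0))⁻¹ * X n ω) (Finset.Icc 1 N) 2
      (fun _ => 1 / (N : ℝ)) ω)
    (hV : V = hermiteSum (fun n ω => (√(autocov X μ 0))⁻¹ * X n ω) (Finset.Icc 1 N) 4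
      (fun _ => 1 / (N : ℝ)) ω) :
    0 < 1 + U ∧ sampleKurtosis X N ω - 3 = (V - 3 * U ^ 2) / (1 + U) ^ 2 := by
  have hN0 : (0 : ℝ) < N := by exact_mod_cast hN
  set S := autocov X μ 0
  have hS2 : (√S)⁻¹ ^ 2 = S⁻¹ := by rw [inv_pow, Real.sq_sqrt hpos.le]
  have hS4 : (√S)⁻¹ ^ 4 = S⁻¹ ^ 2 := by rw [← hS2]; ring
  set a2 := 1 / (N : ℝ) * ∑ n ∈ Finset.Icc 1 N, X n ω * X n ω with ha2
  set a4 := 1 / (N : ℝ) * ∑ n ∈ Finset.Icc 1 N, X n ω ^ 4 with ha4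
  have hc : ∑ n ∈ Finset.Icc 1 N, 1 / (N : ℝ) = 1 := by simp [hN0.ne']
  have eU : U = S⁻¹ * a2 - 1 := by
    refine Eq.trans ?_ (congrArg (S⁻¹ * a2 - ·) hc)
    simp only [hU, hermiteSum, ha2, Finset.mul_sum]
    rw [← Finset.sum_sub_distrib]
    refine Finset.sum_congr rfl fun n _ => ?_
    rw [realHermite_two_eval, mul_pow, hS2]; ring
  have eV : V = S⁻¹ ^ 2 * a4 - 6 * (S⁻¹ * a2) + 3 := by
    have hc3 : 3 * ∑ n ∈ Finset.Icc 1 N, 1 / (N : ℝ) = 3 := by rw [hc, mul_one]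
    refine Eq.trans ?_ (congrArg (S⁻¹ ^ 2 * a4 - 6 * (S⁻¹ * a2) + ·) hc3)
    simp only [hV, hermiteSum, ha2, ha4, Finset.mul_sum]
    rw [← Finset.sum_sub_distrib, ← Finset.sum_add_distrib]
    refine Finset.sum_congr rfl fun n _ => ?_
    rw [realHermite_four_eval, mul_pow, mul_pow, hS2, hS4]; ring
  have hv : sampleVar X N ω = a2 := rfl
  rw [hv] at hω
  have eB : sampleKurtosis X N ω = a4 / a2 ^ 2 := by
    rw [sampleKurtosis, hv, ha4, mul_div_assoc, Finset.sum_div]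
    congr 1
    refine Finset.sum_congr rfl fun n _ => ?_
    rw [div_eq_mul_inv, ← inv_pow]; ring
  have hpos' : 0 < S⁻¹ * a2 := by positivity
  refine ⟨by rw [eU]; linarith, ?_⟩
  rw [eB, eU, eV]
  have : 1 + (S⁻¹ * a2 - 1) = S⁻¹ * a2 := by ring
  rw [this]
  field_simp
  ring

variable [IsProbabilityMeasure μ]

/-- Dividing by the standard deviation standardises a stationary Gaussian process. -/
lemma isStdGaussianProcess_standardize (hgauss : IsGaussianProcess X μ)
    (hstat : IsWideSenseStationary X μ) (hzero : ∀ n, ∫ ω, X n ω ∂μ = 0)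
    (hpos : 0 < autocov X μ 0) :
    IsStdGaussianProcess (fun n ω => (√(autocov X μ 0))⁻¹ * X n ω)
      (fun n m => autocov X μ ((n - m) + (m - n)) / autocov X μ 0) μ where
  gauss := hgauss.smul fun _ => (√(autocov X μ 0))⁻¹
  mean n := by rw [integral_const_mul, hzero, mul_zero]
  corr n m := by
    rw [← covariance_eq_autocov_lag hstat, covariance_eq_sub (hstat.memLp n) (hstat.memLp m),
      hzero, zero_mul, sub_zero, div_eq_inv_mul, ← integral_const_mul]
    refine integral_congr_ae (ae_of_all _ fun ω => ?_)
    have : (√(autocov X μ 0))⁻¹ * (√(autocov X μ 0))⁻¹ = (autocov X μ 0)⁻¹ := by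
      rw [← mul_inv, Real.mul_self_sqrt hpos.le]
    simp only [Pi.mul_apply, ← this]
    ring
  diag n := by simp [hpos.ne']

lemma sampleVar_pos (hgauss : IsGaussianProcess X μ)
    (hstat : IsWideSenseStationary X μ) (hzero : ∀ n, ∫ ω, X n ω ∂μ = 0)
    (hpos : 0 < autocov X μ 0) {N : ℕ} (hN : 1 ≤ N) : ∀ᵐ ω ∂μ, 0 < sampleVar X N ω := by
  have hY := isStdGaussianProcess_standardize hgauss hstat hzero hpos
  have h1 : ∀ᵐ ω ∂μ, (√(autocov X μ 0))⁻¹ * X 1 ω ≠ 0 := by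
    have : NullSingletonClass (gaussianReal 0 1) := nullSingletonClass_gaussianReal one_ne_zero
    have h : ∀ᵐ x ∂(gaussianReal 0 1), x ≠ 0 := by simp [ae_iff]
    rw [← hY.map_eq 1] at h
    exact ae_of_ae_map (hY.gauss.aemeasurable 1) h
  filter_upwards [h1] with ω hω
  have hx : X 1 ω ≠ 0 := right_ne_zero_of_mul hω
  have hN0 : (0 : ℝ) < N := by exact_mod_cast hN
  refine mul_pos (by positivity) (Finset.sum_pos' (fun _ _ => mul_self_nonneg _) ⟨1, ?_, ?_⟩)
  · simp [hN]
  · exact mul_self_pos.2 hx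

lemma memLp_sampleKurtosis (hgauss : IsGaussianProcess X μ) {N : ℕ} (hN : 1 ≤ N) :
    MemLp (sampleKurtosis X N) 2 μ :=
  MemLp.of_bound (aestronglyMeasurable_sampleKurtosis hgauss N) N (ae_of_all _ fun ω => by
    rw [Real.norm_eq_abs, abs_of_nonneg (sampleKurtosis_nonneg N ω)]
    exact sampleKurtosis_le hN ω)

/-- Quantitative form of the expansions, with an error `O(N ^ (-3/2))`. -/
theorem exists_bound_sampleKurtosis (hgauss : IsGaussianProcess X μ)
    (hstat : IsWideSenseStationary X μ) (hzero : ∀ n, ∫ ω, X n ω ∂μ = 0)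
    (hpos : 0 < autocov X μ 0) (hmix : Summable fun τ : ℕ => |autocov X μ τ| ^ 2) :
    ∃ C : ℝ, ∀ N : ℕ, 1 ≤ N →
      |(∫ ω, sampleKurtosis X N ω ∂μ) - (3 - 6 / (N : ℝ) - 12 / (N : ℝ) ^ 2 *
        ∑ τ ∈ Finset.Ico 1 N, ((N : ℝ) - τ) * (autocov X μ τ ^ 2 / autocov X μ 0 ^ 2))| ≤
          C / √N ^ 3 ∧
      |Var[sampleKurtosis X N; μ] - 24 / (N : ℝ) * (1 + 2 / (N : ℝ) *
        ∑ τ ∈ Finset.Ico 1 N, ((N : ℝ) - τ) * (autocov X μ τ ^ 4 / autocov X μ 0 ^ 4))| ≤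
          C / √N ^ 3 := by
  have hY := isStdGaussianProcess_standardize hgauss hstat hzero hpos
  set S := autocov X μ 0 with hS
  set Y : ℕ → Ω → ℝ := fun n ω => (√S)⁻¹ * X n ω with hYdef
  set r : ℕ → ℕ → ℝ := fun n m => autocov X μ ((n - m) + (m - n)) / S with hr
  set L : ℝ := 1 + 2 * ∑' τ, autocov X μ τ ^ 2 / S ^ 2 with hL
  have hsum : Summable fun τ => autocov X μ τ ^ 2 / S ^ 2 := by
    simp only [sq_abs] at hmix
    exact hmix.div_const _
  have hL1 : 1 ≤ L := by
    have : 0 ≤ ∑' τ, autocov X μ τ ^ 2 / S ^ 2 := tsum_nonneg fun τ => by positivity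
    linarith
  -- a common bound for all the moments of `U` and `V`, up to powers of `N`
  obtain ⟨K₁, hK₁⟩ : ∃ K₁ : ℝ, K₁ = 7 ^ 4 * (24 * L) := ⟨_, rfl⟩
  obtain ⟨K, hK⟩ : ∃ K : ℝ, K = K₁ ^ 4 := ⟨_, rfl⟩
  refine ⟨max (1070 * K) (4496 * K + (1073 * K) ^ 2), fun N hN => ?_⟩
  have hN0 : (0 : ℝ) < N := by exact_mod_cast hN
  have hN1 : (1 : ℝ) ≤ N := by exact_mod_cast hN
  have ha1 : 1 ≤ √(N : ℝ) := Real.one_le_sqrt.2 hN1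
  have ha2 : √(N : ℝ) ^ 2 = N := Real.sq_sqrt hN0.le
  have ha4 : √(N : ℝ) ^ 4 = N ^ 2 := by
    rw [show √(N : ℝ) ^ 4 = (√(N : ℝ) ^ 2) ^ 2 by ring, ha2]
  have ha8 : √(N : ℝ) ^ 8 = N ^ 4 := by
    rw [show √(N : ℝ) ^ 8 = (√(N : ℝ) ^ 2) ^ 4 by ring, ha2]
  set U := hermiteSum Y (Finset.Icc 1 N) 2 (fun _ => 1 / (N : ℝ)) with hU
  set V := hermiteSum Y (Finset.Icc 1 N) 4 (fun _ => 1 / (N : ℝ)) with hV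
  have hlag : ∀ k, ∑ n ∈ Finset.Icc 1 N, ∑ m ∈ Finset.Icc 1 N, r n m ^ k =
      N + 2 * ∑ τ ∈ Finset.Ico 1 N, ((N : ℝ) - τ) * (autocov X μ τ ^ k / S ^ k) := by
    intro k
    have h := sum_sum_lag (fun τ => autocov X μ τ ^ k / S ^ k) N
    simp only [← div_pow, ← hS, div_self hpos.ne', one_pow, mul_one] at h ⊢
    exact h
  have hmom : ∀ k, ∫ ω, hermiteSum Y (Finset.Icc 1 N) k (fun _ => 1 / (N : ℝ)) ω ^ 2 ∂μ =
      k.factorial / (N : ℝ) ^ 2 * (N + 2 * ∑ τ ∈ Finset.Ico 1 N,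
        ((N : ℝ) - τ) * (autocov X μ τ ^ k / S ^ k)) := by
    intro k
    rw [hY.integral_hermiteSum_sq, ← hlag]
    simp only [← Finset.mul_sum]
    ring
  have hEU : ∫ ω, U ω ^ 2 ∂μ = 2 / (N : ℝ) ^ 2 * (N + 2 * ∑ τ ∈ Finset.Ico 1 N,
        ((N : ℝ) - τ) * (autocov X μ τ ^ 2 / S ^ 2)) := by
    rw [hU, hmom]; norm_num
  have hEV : ∫ ω, V ω ^ 2 ∂μ = 24 / (N : ℝ) ^ 2 * (N + 2 * ∑ τ ∈ Finset.Ico 1 N,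
        ((N : ℝ) - τ) * (autocov X μ τ ^ 4 / S ^ 4)) := by
    rw [hV, hmom]; norm_num [Nat.factorial]
  have hlag2 : ∑ n ∈ Finset.Icc 1 N, ∑ m ∈ Finset.Icc 1 N, r n m ^ 2 ≤ N * L := by
    rw [hlag, hL]
    have h1 : ∑ τ ∈ Finset.Ico 1 N, ((N : ℝ) - τ) * (autocov X μ τ ^ 2 / S ^ 2) ≤
        ∑ τ ∈ Finset.Ico 1 N, (N : ℝ) * (autocov X μ τ ^ 2 / S ^ 2) := by
      gcongr with τ
      have : (0 : ℝ) ≤ τ := by positivity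
      linarith
    have h2 := hsum.sum_le_tsum (Finset.Ico 1 N) (fun τ _ => by positivity)
    rw [← Finset.mul_sum] at h1
    nlinarith
  have hlag4 : ∑ n ∈ Finset.Icc 1 N, ∑ m ∈ Finset.Icc 1 N, r n m ^ 4 ≤ N * L := by
    refine le_trans ?_ hlag2
    refine Finset.sum_le_sum fun n _ => Finset.sum_le_sum fun m _ => ?_
    have h1 := hY.corr_sq_le_one n m
    have h2 := sq_nonneg (r n m)
    have : r n m ^ 4 = r n m ^ 2 * r n m ^ 2 := by ring
    rw [this]
    exact mul_le_of_le_one_left h2 h1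
  have hU2 : ∫ ω, U ω ^ 2 ∂μ ≤ 24 * L / N := by
    rw [hEU, ← hlag]
    calc _ ≤ 2 / (N : ℝ) ^ 2 * (N * L) := by gcongr
      _ = 2 * L / N := by field_simp
      _ ≤ _ := by gcongr; norm_num
  have hV2 : ∫ ω, V ω ^ 2 ∂μ ≤ 24 * L / N := by
    rw [hEV, ← hlag]
    calc _ ≤ 24 / (N : ℝ) ^ 2 * (N * L) := by gcongr
      _ = _ := by field_simp
  have hU0 : 0 ≤ ∫ ω, U ω ^ 2 ∂μ := integral_nonneg fun ω => sq_nonneg _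
  have hK₁1 : 1 ≤ K₁ := by rw [hK₁]; nlinarith
  have hUK : 7 ^ 2 * ∫ ω, U ω ^ 2 ∂μ ≤ K₁ / N := by
    calc _ ≤ 7 ^ 4 * (24 * L / N) := mul_le_mul (by norm_num) hU2 hU0 (by norm_num)
      _ = K₁ / N := by rw [hK₁]; ring
  have hVK : 7 ^ 4 * ∫ ω, V ω ^ 2 ∂μ ≤ K₁ / N := by
    calc _ ≤ 7 ^ 4 * (24 * L / N) := mul_le_mul_of_nonneg_left hV2 (by norm_num)
      _ = K₁ / N := by rw [hK₁]; ring
  have hUb := hY.integral_hermiteSum_pow_le_of_sq_le (Finset.Icc 1 N) 2 _ hK₁1 hN0 hUK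
  have hVb := hY.integral_hermiteSum_pow_le_of_sq_le (Finset.Icc 1 N) 4 _ hK₁1 hN0 hVK
  rw [← hK] at hUb hVb
  obtain ⟨hm, hv⟩ := abs_integral_ratio_le_and_abs_variance_ratio_le (μ := μ) (U := U) (V := V)
    (B := sampleKurtosis X N) (a := √N) (K := K) ha1
    (hY.hasAllMoments_hermiteSum _ _ _) (hY.hasAllMoments_hermiteSum _ _ _)
    (aestronglyMeasurable_sampleKurtosis hgauss N) (sampleKurtosis_nonneg N)
    (fun ω => by rw [ha2]; exact sampleKurtosis_le hN ω)
    (by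
      filter_upwards [sampleVar_pos hgauss hstat hzero hpos hN] with ω hω
      exact sampleKurtosis_sub_three_eq hpos hN hω rfl rfl)
    (hY.integral_hermiteSum_succ _ 3 _)
    (hY.integral_hermiteSum_mul_of_ne _ (by norm_num) _ _)
    (by rw [ha2]; exact hUb.1) (by rw [ha2]; exact hVb.1) (by rw [ha4]; exact hUb.2.1)
    (by rw [ha4]; exact hVb.2.1) (by rw [ha8]; exact hUb.2.2)
  constructor
  · refine le_trans (le_of_eq ?_) (hm.trans (by gcongr; exact le_max_left _ _))
    congr 1
    rw [hEU]
    field_simp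
    ring
  · refine le_trans (le_of_eq ?_) (hv.trans (by gcongr; exact le_max_right _ _))
    congr 1
    rw [hEV]
    field_simp

lemma isLittleO_one_div_of_le {f : ℕ → ℝ} {C : ℝ} (hf : ∀ N : ℕ, 1 ≤ N → |f N| ≤ C / √N ^ 3) :
    f =o[atTop] fun N : ℕ => 1 / (N : ℝ) := by
  have h0 : Tendsto (fun N : ℕ => C / √(N : ℝ)) atTop (𝓝 0) :=
    (Real.tendsto_sqrt_atTop.comp tendsto_natCast_atTop_atTop).const_div_atTop C
  have h1 : (fun N : ℕ => C / √(N : ℝ) * (1 / (N : ℝ))) =o[atTop] fun N : ℕ => 1 / (N : ℝ) := by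
    simpa using ((isLittleO_one_iff ℝ).2 h0).mul_isBigO
      (isBigO_refl (fun N : ℕ => 1 / (N : ℝ)) atTop)
  refine IsBigO.trans_isLittleO (IsBigO.of_bound 1 ?_) h1
  filter_upwards [eventually_ge_atTop 1] with N hN
  rw [one_mul, Real.norm_eq_abs, Real.norm_eq_abs]
  refine (hf N hN).trans (le_trans (le_of_eq ?_) (le_abs_self _))
  rw [div_mul_div_comm, mul_one]
  congr 1
  rw [pow_succ, Real.sq_sqrt (by positivity), mul_comm]

end

theorem mainTheorem1 {Ω : Type*} [MeasurableSpace Ω] (μ : Measure Ω) [IsProbabilityMeasure μ]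
    (X : ℕ → Ω → ℝ)
    (hgauss : IsGaussianProcess X μ)
    (hstat : IsWideSenseStationary X μ)
    (hzero : ∀ n, ∫ ω, X n ω ∂μ = 0)
    (hpos : 0 < autocov X μ 0)
    (hmix : Summable fun τ : ℕ => |autocov X μ τ| ^ 2) :
    -- the statistic is almost surely well defined and has a mean and a variance
    (∀ N : ℕ, 1 ≤ N →
      (∀ᵐ ω ∂μ, 0 < sampleVar X N ω) ∧ MemLp (sampleKurtosis X N) 2 μ) ∧
    -- mean
    ((fun N : ℕ => (∫ ω, sampleKurtosis X N ω ∂μ) -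
        (3 - 6 / (N : ℝ) - 12 / (N : ℝ) ^ 2 *
          ∑ τ ∈ Finset.Ico 1 N,
            ((N : ℝ) - (τ : ℝ)) * (autocov X μ τ ^ 2 / autocov X μ 0 ^ 2)))
      =o[atTop] fun N : ℕ => 1 / (N : ℝ)) ∧
    -- variance
    ((fun N : ℕ => Var[sampleKurtosis X N; μ] -
        24 / (N : ℝ) * (1 + 2 / (N : ℝ) *
          ∑ τ ∈ Finset.Ico 1 N,
            ((N : ℝ) - (τ : ℝ)) * (autocov X μ τ ^ 4 / autocov X μ 0 ^ 4)))
      =o[atTop] fun N : ℕ => 1 / (N : ℝ)) ∧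
    -- the i.i.d. case
    (iIndepFun X μ →
      (∀ τ : ℕ, 1 ≤ τ → autocov X μ τ = 0) ∧
      ((fun N : ℕ => (∫ ω, sampleKurtosis X N ω ∂μ) - (3 - 6 / (N : ℝ)))
        =o[atTop] fun N : ℕ => 1 / (N : ℝ)) ∧
      ((fun N : ℕ => Var[sampleKurtosis X N; μ] - 24 / (N : ℝ))
        =o[atTop] fun N : ℕ => 1 / (N : ℝ))) := by
  obtain ⟨C, hC⟩ := exists_bound_sampleKurtosis hgauss hstat hzero hpos hmix
  have hmean := isLittleO_one_div_of_le fun N hN => (hC N hN).1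
  have hvar := isLittleO_one_div_of_le fun N hN => (hC N hN).2
  refine ⟨fun N hN => ⟨sampleVar_pos hgauss hstat hzero hpos hN, memLp_sampleKurtosis hgauss hN⟩,
    hmean, hvar, fun hind => ?_⟩
  have hzero_lag : ∀ τ : ℕ, 1 ≤ τ → autocov X μ τ = 0 := fun τ hτ =>
    (hind.indepFun (show 0 ≠ τ by omega)).covariance_eq_zero (hstat.memLp 0) (hstat.memLp τ)
  have hsum : ∀ (N k : ℕ), k ≠ 0 → ∑ τ ∈ Finset.Ico 1 N,
      ((N : ℝ) - (τ : ℝ)) * (autocov X μ τ ^ k / autocov X μ 0 ^ k) = 0 := fun N k hk =>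
    Finset.sum_eq_zero fun τ hτ => by
      rw [hzero_lag τ (Finset.mem_Ico.1 hτ).1, zero_pow hk, zero_div, mul_zero]
  refine ⟨hzero_lag, ?_, ?_⟩
  · simpa only [hsum _ 2 two_ne_zero, mul_zero, sub_zero] using hmean
  · simpa only [hsum _ 4 four_ne_zero, mul_zero, add_zero, mul_one] using hvar
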